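/- Let $\mathbf K$ be an algebraically closed field, $N\ge 0$, and $(\mathbf P^N)^\circ=\mathbf P^N\setminus\{x_0\cdots x_N=0\}$. Let $X\subset\mathbf P^N$ be a projective toric variety of dimension $n$ meeting $(\mathbf P^N)^\circ$; that is, for some $m\ge 0$, $\mathcal A=(a_0,\dots,a_N)\in(\mathbf Z^m)^{N+1}$ and $\alpha\in(\mathbf K^\times)^{N+1}$, $X$ is the Zariski closure of $\{(\alpha_0s^{a_0}:\dots:\alpha_Ns^{a_N}) : s\in(\mathbf K^\times)^m\}$. Let $$\Gamma_X=\Big\{\lambda\in\mathbf Z^{N+1} : \sum_k\lambda_k=0,\ \sum_k\lambda_ka_k=0\Big\}$$ be its associated lattice. For $i=1,\dots,N-n$ let $$\omega_i(X;(\mathbf P^N)^\circ)=\min\{D\in\mathbf N : \dim(Z(f : f\in I(X)_D)\cap(\mathbf P^N)^\circ)\le N-i\},$$ where $I(X)_D$ is the degree-$D$ part of the homogeneous ideal $I(X)\subset\mathbf K[x_0,\dots,x_N]$ of $X$ and $Z$ denotes the set of common zeros in $\mathbf P^N$; and let $\mu_i(\Gamma_X;\|\cdot\|_1)$ be the least real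 $\nu\ge0$ such that $\Gamma_X$ contains $i$ linearly independent vectors of $\ell^1$ norm at most $\nu$. Then these minima exist and $$\omega_i(X;(\mathbf P^N)^\circ)=\tfrac12\,\mu_i(\Gamma_X;\|\cdot\|_1)\qquad (i=1,\dots,N-n).$$ Moreover, these indices are realized by binomial equations: there are binomials $f_1,\dots,f_{N-n}\in I(X)$ (polynomials $c\,x^a-d\,x^b$ with $c,d\in\mathbf K^\times$ and $a\ne b$), with $f_j$ homogeneous of degree $\omega_j(X;(\mathbf P^N)^\circ)$, such that $\dim(Z(f_1,\dots,f_i)\cap(\mathbf P^N)^\circ)=N-i$ for every $0\le i\le N-n$. -/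

import Mathlib

open scoped LinearAlgebra.Projectivization

noncomputable section

namespace ToricObstruction

/-- The projective space `P^N` over `K`, as its set of `K`-points. -/
abbrev ProjSpace (K : Type*) [Field K] (N : ℕ) : Type _ := ℙ K (Fin (N + 1) → K)

section Projective

variable {K : Type*} [Field K] {N : ℕ}

/-- `f` vanishes at `p`, that is, on the whole line of `K^(N+1)` represented by `p`.
For a homogeneous `f` this can be tested on any single representative. -/
def VanishesAt (f : MvPolynomial (Fin (N + 1)) K) (p : ProjSpace K N) : Prop :=
  ∀ v ∈ p.submodule, MvPolynomial.eval v f = 0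

/-- The set `Z(S)` of common zeros in `P^N` of a set `S` of polynomials. -/
def zeroSet (S : Set (MvPolynomial (Fin (N + 1)) K)) : Set (ProjSpace K N) :=
  {p | ∀ f ∈ S, VanishesAt f p}

/-- The homogeneous ideal `I(X)` of polynomials vanishing on `X ⊆ P^N`. -/
def definingIdeal (X : Set (ProjSpace K N)) : Ideal (MvPolynomial (Fin (N + 1)) K) where
  carrier := {f | ∀ p ∈ X, VanishesAt f p}
  zero_mem' := by
    intro p _ v _
    simp
  add_mem' := by
    intro f g hf hg p hp v hv
    simp [hf p hp v hv, hg p hp v hv]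
  smul_mem' := by
    intro c f hf p hp v hv
    simp [hf p hp v hv]

/-- The part `I(X)_D` of degree `D` of the homogeneous ideal `I(X)`. -/
def idealPart (X : Set (ProjSpace K N)) (D : ℕ) : Set (MvPolynomial (Fin (N + 1)) K) :=
  {f | f ∈ definingIdeal X ∧ f.IsHomogeneous D}

/-- The Zariski topology on `P^N`: the complements of the hypersurfaces `Z(f)`,
with `f` homogeneous, form a basis of open sets. -/
instance zariskiTopology : TopologicalSpace (ProjSpace K N) :=
  TopologicalSpace.generateFrom
    {W | ∃ (D : ℕ) (f : MvPolynomial (Fin (N + 1)) K),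
      f.IsHomogeneous D ∧ W = (zeroSet {f})ᶜ}

/-- The dimension of a subset of `P^N`: the Krull dimension of the subset with the topology
induced by the Zariski topology. The empty set has dimension `⊥`. -/
def zariskiDim (Y : Set (ProjSpace K N)) : WithBot ℕ∞ :=
  topologicalKrullDim Y

variable (K N) in
/-- The open torus `(P^N)°`, the complement of the coordinate hyperplanes. -/
def openTorus : Set (ProjSpace K N) :=
  {p | ∀ k, p.rep k ≠ 0}

/-- The degrees `D` such that `dim (Z(f : f ∈ I(X)_D) ∩ U) ≤ N - i`. -/
def obstructionDegrees (X U : Set (ProjSpace K N)) (i : ℕ) : Set ℕ :=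
  {D | zariskiDim (zeroSet (idealPart X D) ∩ U) + (i : WithBot ℕ∞) ≤ (N : WithBot ℕ∞)}

/-- The `i`-th successive obstruction index `ω_i(X; U)` of `X` relative to `U`. -/
def obstructionIndex (X U : Set (ProjSpace K N)) (i : ℕ) : ℕ :=
  sInf (obstructionDegrees X U i)

/-- Binomials `c x^a - d x^b` with `c, d` nonzero and `a ≠ b`. -/
def IsBinomial (f : MvPolynomial (Fin (N + 1)) K) : Prop :=
  ∃ (a b : Fin (N + 1) →₀ ℕ) (c d : K), a ≠ b ∧ c ≠ 0 ∧ d ≠ 0 ∧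
    f = MvPolynomial.monomial a c - MvPolynomial.monomial b d

/-- The monomial map `s ↦ (α_0 s^(a_0) : ... : α_N s^(a_N))` from `G_m^m` to `P^N`. -/
def monomialMap {m : ℕ} (A : Fin (N + 1) → Fin m → ℤ) (α : Fin (N + 1) → Kˣ)
    (s : Fin m → Kˣ) : ProjSpace K N :=
  Projectivization.mk K (fun k => ((α k * ∏ j, s j ^ A k j : Kˣ) : K))
    (fun h => Units.ne_zero _ (congrFun h 0))

/-- The projective toric variety `X_{A,α}`, the Zariski closure of the image of the
monomial map. -/
def toricVariety {m : ℕ} (A : Fin (N + 1) → Fin m → ℤ) (α : Fin (N + 1) → Kˣ) :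
    Set (ProjSpace K N) :=
  closure (Set.range (monomialMap A α))

end Projective

section Lattice

variable {N : ℕ}

/-- The lattice of `X_{A,α}`: the kernel of
`Z^(N+1) → Z × Z^m`, `l ↦ (l_0 + ... + l_N, l_0 a_0 + ... + l_N a_N)`. -/
def toricLattice {m : ℕ} (A : Fin (N + 1) → Fin m → ℤ) : Submodule ℤ (Fin (N + 1) → ℤ) :=
  LinearMap.ker (Fintype.linearCombination ℤ (fun k => ((1 : ℤ), A k)))

/-- The `ℓ¹` norm of an integer vector. -/
def l1Norm (v : Fin (N + 1) → ℤ) : ℝ := ∑ k, |(v k : ℝ)|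

/-- The real numbers `ν ≥ 0` such that `Γ` contains `i` linearly independent vectors of
`ℓ¹` norm at most `ν`. -/
def minimumBounds (Γ : Submodule ℤ (Fin (N + 1) → ℤ)) (i : ℕ) : Set ℝ :=
  {ν | 0 ≤ ν ∧ ∃ v : Fin i → Fin (N + 1) → ℤ,
    LinearIndependent ℤ v ∧ ∀ j, v j ∈ Γ ∧ l1Norm (v j) ≤ ν}

/-- The `i`-th successive minimum `μ_i(Γ; ‖·‖₁)`. -/
def successiveMinimum (Γ : Submodule ℤ (Fin (N + 1) → ℤ)) (i : ℕ) : ℝ :=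
  sInf (minimumBounds Γ i)

end Lattice

end ToricObstruction

end

open ToricObstruction

/-!
Write `T` for the torus of `P^N`. After rescaling the coordinates by `α`, a point of `T` is given by
`u ∈ (Kˣ)^(N+1)` up to scaling, and an integer vector `l` with `∑ l_k = 0` defines a character
`u ↦ u^l` of `T`. A lattice `L` of such vectors defines the subgroup where its characters are
trivial; its translate by `α` is `toricCoset α L`. The proof has three ingredients.

*Equations.* A homogeneous `f` of degree `D` vanishes on `X` exactly when its restriction to the
image of the monomial map is zero. By Dedekind's independence of characters its terms then cancel
within each class of monomials with the same restriction. Two monomials in a class differ by an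
`l ∈ Γ_X` with `‖l‖₁ ≤ 2 D`, and conversely each such `l` gives a binomial of degree `D`, made
homogeneous of the right degree by a power of `x_0`. Hence the zero set of `I(X)_D` in `T` is
`toricCoset α L_D`, with `L_D` generated by the vectors of `Γ_X` of norm at most `2 D`
(`zeroSet_idealPart_inter_openTorus`).

*Dimension.* `dim (toricCoset α L) = N - rank L` (`zariskiDim_toricCoset_add`). In the chart
`x_0 = α_0` the coset is the set of closed points of the spectrum of the group algebra `K[Q]`, where
`Q = ℤ^(N+1) / (L + ℤ e_0)` has rank `N - rank L`, and the Krull dimension of `K[Q]` is the rank of `Q`: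
if `q_1, ..., q_r` are independent in `Q` and generate a subgroup of finite index, `K[Q]` is integral
over its subalgebra generated by the `[q_i] + [-q_i]`, which are algebraically independent. This
treats disconnected and nonreduced subgroups on the same footing.

*Lattices.* So `D` is an admissible degree for `ω_i` if and only if `i ≤ rank L_D`, that is, if and
only if `Γ_X` contains `i` independent vectors of norm at most `2 D`. Norms of vectors of `Γ_X` are
even integers, which gives `μ_i = 2 ω_i`. Since `X` contains the coset of `Γ_X`, the rank of `Γ_X`
is at least `N - n`, so the minima exist for `i ≤ N - n`. A greedy choice of independent vectors
(`exists_linearIndependent_forall_mem`) yields the binomials realizing all the indices.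
-/

noncomputable section

namespace ToricObstruction

open TopologicalSpace Module

/-! ### Krull dimension: integral extensions, Jacobson spaces, group algebras -/

/-- Incomparability bounds the dimension of `S`, lying over and going up that of `R`. -/
theorem ringKrullDim_eq_of_isIntegral_of_injective {R S : Type*} [CommRing R] [CommRing S]
    [Algebra R S] [Algebra.IsIntegral R S]
    (hinj : Function.Injective (algebraMap R S)) : ringKrullDim S = ringKrullDim R := by
  apply le_antisymm
  · exact Order.krullDim_le_of_strictMono (PrimeSpectrum.comap (algebraMap R S))
      fun I J hIJ => Ideal.IsIntegral.comap_lt_comap (I := I.asIdeal) (J := J.asIdeal) hIJ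
  · refine iSup_le fun l => ?_
    obtain ⟨Q, -, hQ, hQl⟩ := Ideal.exists_ideal_over_prime_of_isIntegral (S := S)
      l.head.asIdeal ⊥ (by
        rw [← RingHom.ker_eq_comap_bot, (RingHom.injective_iff_ker_eq_bot _).mp hinj]
        exact bot_le)
    have : Q.LiesOver l.head.asIdeal := ⟨hQl.symm⟩
    obtain ⟨L, hL, -, -⟩ := Ideal.exists_ltSeries_of_hasGoingUp l Q
    rw [← hL]
    exact Order.LTSeries.length_le_krullDim L

/-- The irreducible closed subsets of a Jacobson space are determined by their closed points. -/
theorem topologicalKrullDim_eq_of_isInducing_of_range_eq_closedPoints {X Y : Type*}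
    [TopologicalSpace X] [TopologicalSpace Y] [JacobsonSpace X] {f : Y → X}
    (hf : Topology.IsInducing f) (hrange : Set.range f = closedPoints X) :
    topologicalKrullDim Y = topologicalKrullDim X := by
  refine le_antisymm hf.topologicalKrullDim_le ?_
  have hcl (Z : IrreducibleCloseds X) : closure (f '' (f ⁻¹' (Z : Set X))) = Z := by
    rw [Set.image_preimage_eq_inter_range, hrange, closure_inter_closedPoints Z.isClosed]
  have hirr (Z : IrreducibleCloseds X) : IsIrreducible (f ⁻¹' (Z : Set X)) := by
    have h1 : IsIrreducible (f '' (f ⁻¹' (Z : Set X))) := by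
      rw [← isIrreducible_iff_closure, hcl]
      exact Z.isIrreducible
    refine ⟨Set.image_nonempty.mp h1.nonempty, ?_⟩
    rintro _ _ hu hv ⟨x, hx, hxu⟩ ⟨y, hy, hyv⟩
    obtain ⟨u, hu', rfl⟩ := hf.isOpen_iff.mp hu
    obtain ⟨v, hv', rfl⟩ := hf.isOpen_iff.mp hv
    obtain ⟨_, ⟨z, hz, rfl⟩, hzuv⟩ := h1.isPreirreducible u v hu' hv'
      ⟨f x, ⟨x, hx, rfl⟩, hxu⟩ ⟨f y, ⟨y, hy, rfl⟩, hyv⟩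
    exact ⟨z, hz, hzuv⟩
  refine Order.krullDim_le_of_strictMono
    (fun Z => ⟨f ⁻¹' (Z : Set X), hirr Z, Z.isClosed.preimage hf.continuous⟩)
    (Monotone.strictMono_of_injective (fun Z W h =>
      Set.preimage_mono (f := f) (SetLike.coe_subset_coe.mpr h)) fun Z W h => ?_)
  have h' : f ⁻¹' (Z : Set X) = f ⁻¹' (W : Set X) := congrArg IrreducibleCloseds.carrier h
  exact IrreducibleCloseds.ext (by rw [← hcl Z, ← hcl W, h'])

section GroupAlgebra

open AddMonoidAlgebra

variable (K : Type*) [Field K] {Q : Type*} [AddCommGroup Q]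

/-- The algebra map `K[t_i] → K[Q]` sending `t_i` to `[q_i] + [-q_i]`. The group algebra of the
subgroup generated by the `q_i` is integral over its image. -/
def addNegHom {ι : Type*} (q : ι → Q) : MvPolynomial ι K →ₐ[K] K[Q] :=
  MvPolynomial.aeval fun i => single (q i) 1 + single (-q i) 1

variable {K}

/-- The elements `[q_i] + [-q_i]` are algebraically independent: every value of `x + x⁻¹` is
attained on a torus, so a polynomial relation between them vanishes at all points. -/
theorem addNegHom_injective [IsAlgClosed K] {ι : Type*} [Finite ι] {q : ι → Q}
    (hq : LinearIndependent ℤ q) : Function.Injective (addNegHom K q) := by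
  have := Fintype.ofFinite ι
  let g : (ι →₀ ℤ) →+ Q := (Finsupp.linearCombination ℤ q).toAddMonoidHom
  have hfac : addNegHom K q =
      (mapDomainAlgHom K K g).comp (addNegHom K fun i => Finsupp.single i 1) := by
    apply MvPolynomial.algHom_ext
    intro i
    simp [addNegHom, g, mapDomainAlgHom, mapDomain_add, mapDomain_single]
  have hg : Function.Injective (mapDomainAlgHom K K g) := mapDomain_injective hq
  rw [hfac, AlgHom.coe_comp]
  refine hg.comp ((injective_iff_map_eq_zero _).mpr fun f hf => MvPolynomial.funext fun a => ?_)
  have hx (i : ι) : ∃ x : Kˣ, (x : K) + ((x⁻¹ : Kˣ) : K) = a i := by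
    let p : Polynomial K := .X ^ 2 - .C (a i) * .X + 1
    have hp : p.degree = 2 := by
      simp only [p]
      compute_degree!
    obtain ⟨x, hx⟩ := IsAlgClosed.exists_root p (by rw [hp]; decide)
    have hx' : x ^ 2 - a i * x + 1 = 0 := by simpa [p] using hx
    have hx0 : x ≠ 0 := by rintro rfl; simp at hx'
    refine ⟨Units.mk0 x hx0, ?_⟩
    simp only [Units.val_mk0, Units.val_inv_eq_inv_val]
    field_simp
    linear_combination hx'
  choose x hx using hx
  let χ : Multiplicative (ι →₀ ℤ) →* K := (Units.coeHom K).comp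
    (AddMonoidHom.toMultiplicativeLeft
      (Finsupp.linearCombination ℤ fun i => Additive.ofMul (x i)).toAddMonoidHom)
  have hev : (lift K K (ι →₀ ℤ) χ).comp (addNegHom K fun i => Finsupp.single i 1) =
      MvPolynomial.aeval a := by
    apply MvPolynomial.algHom_ext
    intro i
    simp [addNegHom, χ, lift_single, ← hx]
  have := DFunLike.congr_fun hev f
  rw [AlgHom.comp_apply, hf, map_zero] at this
  simpa [MvPolynomial.aeval_eq_eval] using this.symm

/-- If some nonzero multiple of each element of `Q` is a combination of the `q_i`, then `K[Q]` is
integral over the subalgebra generated by the `[q_i] + [-q_i]`. -/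
theorem addNegHom_isIntegral {ι : Type*} {q : ι → Q}
    (hq : ∀ x : Q, ∃ n : ℤ, n ≠ 0 ∧ n • x ∈ Submodule.span ℤ (Set.range q)) :
    (addNegHom K q).toRingHom.IsIntegral := by
  let := (addNegHom K q).toRingHom.toAlgebra
  have hmul (x y : Q) : (single (x + y) 1 : K[Q]) = single x 1 * single y 1 := by
    simp [single_mul_single]
  have hpow (x : Q) (n : ℕ) : (single (n • x) 1 : K[Q]) = single x 1 ^ n := by
    simp [single_pow]
  have hone : (single (0 : Q) 1 : K[Q]) = 1 := rfl
  -- `[q]` and `[-q]` are the two roots of `X ^ 2 - ([q] + [-q]) X + 1`.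
  have hroot (i : ι) (y : K[Q]) (hy : y ^ 2 - (single (q i) 1 + single (-q i) 1) * y + 1 = 0) :
      IsIntegral (MvPolynomial ι K) y := by
    refine ⟨.X ^ 2 - .C (.X i) * .X + 1, ?_, ?_⟩
    · monicity!
    · have : algebraMap (MvPolynomial ι K) K[Q] (.X i) = single (q i) 1 + single (-q i) 1 := by
        change addNegHom K q (.X i) = _
        simp [addNegHom]
      simpa [this] using hy
  have hgen (i : ι) : IsIntegral (MvPolynomial ι K) (single (q i) 1 : K[Q]) ∧
      IsIntegral (MvPolynomial ι K) (single (-q i) 1 : K[Q]) := by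
    have h : (single (q i) 1 : K[Q]) * single (-q i) 1 = 1 := by rw [← hmul, add_neg_cancel, hone]
    constructor
    · exact hroot i _ (by linear_combination -h)
    · exact hroot i _ (by linear_combination -h)
  have hspan (x : Q) (hx : x ∈ Submodule.span ℤ (Set.range q)) :
      IsIntegral (MvPolynomial ι K) (single x 1 : K[Q]) ∧
      IsIntegral (MvPolynomial ι K) (single (-x) 1 : K[Q]) := by
    induction hx using Submodule.span_induction with
    | mem x hx => obtain ⟨i, rfl⟩ := hx; exact hgen i
    | zero => simpa [hone] using isIntegral_one
    | add x y _ _ hx hy =>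
      rw [neg_add, hmul, hmul]
      exact ⟨hx.1.mul hy.1, hx.2.mul hy.2⟩
    | smul n x _ hx =>
      obtain ⟨k, rfl | rfl⟩ := n.eq_nat_or_neg
      · rw [natCast_zsmul, ← smul_neg, hpow, hpow]
        exact ⟨hx.1.pow k, hx.2.pow k⟩
      · rw [neg_smul, natCast_zsmul, neg_neg, ← smul_neg, hpow, hpow]
        exact ⟨hx.2.pow k, hx.1.pow k⟩
  intro g
  change IsIntegral (MvPolynomial ι K) g
  induction g using AddMonoidAlgebra.induction_on with
  | of x =>
    obtain ⟨n, hn, hx⟩ := hq x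
    have h := hspan _ hx
    refine IsIntegral.of_pow (n := n.natAbs) (Int.natAbs_pos.mpr hn) ?_
    change IsIntegral (MvPolynomial ι K) ((single x 1 : K[Q]) ^ n.natAbs)
    rw [← hpow, ← natCast_zsmul]
    rcases abs_choice n with hn' | hn' <;> rw [Int.natCast_natAbs, hn']
    · exact h.1
    · rw [neg_smul]; exact h.2
  | add x y hx hy => exact hx.add hy
  | smul r x hx =>
    have : r • x = algebraMap (MvPolynomial ι K) K[Q] (.C r) * x := by
      rw [Algebra.smul_def]
      congr 1
      exact ((addNegHom K q).commutes r).symm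
    rw [this]
    exact isIntegral_algebraMap.mul hx

theorem ringKrullDim_addMonoidAlgebra [IsAlgClosed K] [Module.Finite ℤ Q] :
    ringKrullDim K[Q] = finrank ℤ Q := by
  obtain ⟨q, hq⟩ := exists_linearIndependent_of_le_finrank (R := ℤ) (M := Q) le_rfl
  have htors : ∀ x : Q, ∃ n : ℤ, n ≠ 0 ∧ n • x ∈ Submodule.span ℤ (Set.range q) := by
    have h0 := Submodule.finrank_quotient_add_finrank (Submodule.span ℤ (Set.range q))
    rw [finrank_span_eq_card hq, Fintype.card_fin, Nat.add_eq_right,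
      finrank_eq_zero_iff_isTorsion] at h0
    intro x
    obtain ⟨n, hn⟩ := @h0 (Submodule.Quotient.mk x)
    refine ⟨n, nonZeroDivisors.coe_ne_zero n, ?_⟩
    rwa [← Submodule.Quotient.mk_eq_zero]
  let := (addNegHom K q).toRingHom.toAlgebra
  have : Algebra.IsIntegral (MvPolynomial (Fin (finrank ℤ Q)) K) K[Q] :=
    ⟨addNegHom_isIntegral htors⟩
  rw [ringKrullDim_eq_of_isIntegral_of_injective (R := MvPolynomial (Fin (finrank ℤ Q)) K)
    (addNegHom_injective hq), MvPolynomial.ringKrullDim_of_isNoetherianRing]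
  simp

end GroupAlgebra

/-! ### Cosets of subgroups of the torus -/

section Torus

variable {K : Type*} [Field K] {N : ℕ}

/-- The character group of `G_m^(N+1)` evaluated at a point `u`: the homomorphism
`l ↦ u_0 ^ l_0 ⋯ u_N ^ l_N`, with values in the additive copy of `Kˣ`. -/
def torusCharacter (u : Fin (N + 1) → Kˣ) : (Fin (N + 1) → ℤ) →ₗ[ℤ] Additive Kˣ :=
  Fintype.linearCombination ℤ fun k => Additive.ofMul (u k)

theorem toMul_torusCharacter (u : Fin (N + 1) → Kˣ) (l : Fin (N + 1) → ℤ) :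
    (torusCharacter u l).toMul = ∏ k, u k ^ l k := by
  simp [torusCharacter, Fintype.linearCombination_apply, toMul_sum, toMul_zsmul]

theorem torusCharacter_eq_zero_iff (u : Fin (N + 1) → Kˣ) (l : Fin (N + 1) → ℤ) :
    torusCharacter u l = 0 ↔ ∏ k, u k ^ l k = 1 := by
  rw [← toMul_torusCharacter, toMul_eq_one]

/-- The point `(α_0 u_0 : ... : α_N u_N)` of the torus in `P^N`. -/
def torusPoint (α u : Fin (N + 1) → Kˣ) : ProjSpace K N :=
  Projectivization.mk K (fun k => ((α k * u k : Kˣ) : K))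
    (fun h => Units.ne_zero _ (congrFun h 0))

theorem torusPoint_eq_iff (α u w : Fin (N + 1) → Kˣ) :
    torusPoint α u = torusPoint α w ↔ ∃ c : Kˣ, ∀ k, u k = c * w k := by
  rw [torusPoint, torusPoint, Projectivization.mk_eq_mk_iff]
  refine exists_congr fun c => ?_
  rw [funext_iff]
  refine forall_congr' fun k => ?_
  rw [Pi.smul_apply, Units.smul_def, smul_eq_mul, ← Units.val_mul, Units.val_inj, eq_comm,
    mul_left_comm, mul_right_inj]

theorem torusPoint_smul (α u : Fin (N + 1) → Kˣ) (c : Kˣ) :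
    torusPoint α (fun k => c * u k) = torusPoint α u :=
  (torusPoint_eq_iff _ _ _).mpr ⟨c, fun _ => rfl⟩

theorem torusPoint_mem_openTorus (α u : Fin (N + 1) → Kˣ) :
    torusPoint α u ∈ openTorus K N := by
  intro k
  obtain ⟨a, ha⟩ := Projectivization.exists_smul_eq_mk_rep K
    (fun k => ((α k * u k : Kˣ) : K)) (fun h => Units.ne_zero _ (congrFun h 0))
  rw [torusPoint, ← ha, Pi.smul_apply, Units.smul_def, smul_eq_mul]
  exact mul_ne_zero a.ne_zero (Units.ne_zero _)

theorem exists_eq_torusPoint (α : Fin (N + 1) → Kˣ) {p : ProjSpace K N}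
    (hp : p ∈ openTorus K N) : ∃ u : Fin (N + 1) → Kˣ, p = torusPoint α u := by
  refine ⟨fun k => (α k)⁻¹ * Units.mk0 (p.rep k) (hp k), ?_⟩
  conv_lhs => rw [← p.mk_rep]
  simp [torusPoint]

theorem isClosed_zeroSet_singleton {f : MvPolynomial (Fin (N + 1)) K} {D : ℕ}
    (hf : f.IsHomogeneous D) : IsClosed (zeroSet {f} : Set (ProjSpace K N)) :=
  ⟨isOpen_generateFrom_of_mem (g := {W | ∃ (D : ℕ) (f : MvPolynomial (Fin (N + 1)) K),
    f.IsHomogeneous D ∧ W = (zeroSet {f})ᶜ}) ⟨D, f, hf, rfl⟩⟩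

theorem vanishesAt_mk_iff {f : MvPolynomial (Fin (N + 1)) K} {D : ℕ} (hf : f.IsHomogeneous D)
    (v : Fin (N + 1) → K) (hv : v ≠ 0) :
    VanishesAt f (Projectivization.mk K v hv) ↔ MvPolynomial.eval v f = 0 := by
  simp only [VanishesAt, Projectivization.submodule_mk, Submodule.mem_span_singleton]
  refine ⟨fun h => h _ ⟨1, one_smul _ _⟩, ?_⟩
  rintro h _ ⟨c, rfl⟩
  have : MvPolynomial.eval (c • v) f = c ^ D * MvPolynomial.eval v f := by
    rw [MvPolynomial.eval_eq, MvPolynomial.eval_eq, Finset.mul_sum]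
    refine Finset.sum_congr rfl fun a ha => ?_
    have hD : a.degree = D := by
      by_contra hne
      exact MvPolynomial.mem_support_iff.mp ha (hf.coeff_eq_zero hne)
    simp only [Pi.smul_apply, smul_eq_mul, mul_pow, Finset.prod_mul_distrib]
    rw [Finset.prod_pow_eq_pow_sum, ← hD, Finsupp.degree_apply]
    ring
  rw [this, h, mul_zero]

theorem vanishesAt_torusPoint_iff {f : MvPolynomial (Fin (N + 1)) K} {D : ℕ}
    (hf : f.IsHomogeneous D) (α u : Fin (N + 1) → Kˣ) :
    VanishesAt f (torusPoint α u) ↔ MvPolynomial.eval (fun k => (α k * u k : K)) f = 0 :=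
  vanishesAt_mk_iff hf _ _

theorem prod_zpow_eq_zpow_sum {G ι : Type*} [CommGroup G] (s : Finset ι) (c : G) (n : ι → ℤ) :
    ∏ k ∈ s, c ^ n k = c ^ ∑ k ∈ s, n k := by
  induction s using Finset.cons_induction with
  | empty => simp
  | cons k s hk ih => rw [Finset.prod_cons, Finset.sum_cons, ih, zpow_add]

theorem torusCharacter_smul {l : Fin (N + 1) → ℤ} (hl : ∑ k, l k = 0) (u : Fin (N + 1) → Kˣ)
    (c : Kˣ) : torusCharacter (fun k => c * u k) l = torusCharacter u l := by
  apply Additive.toMul.injective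
  simp only [toMul_torusCharacter, mul_zpow, Finset.prod_mul_distrib]
  rw [prod_zpow_eq_zpow_sum, hl, zpow_zero, one_mul]

/-- The translate by `α` of the image in the torus of `P^N` of the subgroup
`{u : u^l = 1 for all l ∈ L}` of `(Kˣ)^(N+1)`. -/
def toricCoset (α : Fin (N + 1) → Kˣ) (L : Submodule ℤ (Fin (N + 1) → ℤ)) :
    Set (ProjSpace K N) :=
  {p | ∃ u : Fin (N + 1) → Kˣ, L ≤ LinearMap.ker (torusCharacter u) ∧ p = torusPoint α u}

theorem exists_normalized_of_mem_toricCoset {α : Fin (N + 1) → Kˣ}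
    {L : Submodule ℤ (Fin (N + 1) → ℤ)} (hL : ∀ l ∈ L, ∑ k, l k = 0) {p : ProjSpace K N}
    (hp : p ∈ toricCoset α L) :
    ∃ u : Fin (N + 1) → Kˣ, u 0 = 1 ∧ L ≤ LinearMap.ker (torusCharacter u) ∧
      torusPoint α u = p := by
  obtain ⟨u, hu, rfl⟩ := hp
  refine ⟨fun k => (u 0)⁻¹ * u k, inv_mul_cancel _, ?_, torusPoint_smul _ _ _⟩
  intro l hl
  rw [LinearMap.mem_ker, torusCharacter_smul (hL l hl)]
  exact hu hl

/-! ### The coordinate ring and the dimension of a coset -/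

/-- `L + ℤ e_0`. In the chart `x_0 = α_0` of the torus, the quotient of `ℤ^(N+1)` by this lattice
is the group of monomial functions on the coset of `L`. -/
def chartLattice (L : Submodule ℤ (Fin (N + 1) → ℤ)) : Submodule ℤ (Fin (N + 1) → ℤ) :=
  L ⊔ Submodule.span ℤ {Pi.single 0 1}

theorem finrank_quotient_chartLattice {L : Submodule ℤ (Fin (N + 1) → ℤ)}
    (hL : ∀ l ∈ L, ∑ k, l k = 0) :
    finrank ℤ ((Fin (N + 1) → ℤ) ⧸ chartLattice L) + finrank ℤ L = N := by
  have h1 := Submodule.finrank_quotient_add_finrank (chartLattice L)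
  have h2 := Submodule.rank_sup_add_rank_inf_eq L (Submodule.span ℤ {Pi.single 0 1})
  have hinf : L ⊓ Submodule.span ℤ {Pi.single 0 1} = ⊥ := by
    rw [eq_bot_iff]
    rintro x ⟨hx, hx'⟩
    obtain ⟨c, rfl⟩ := Submodule.mem_span_singleton.mp hx'
    have := hL _ hx
    simp only [Pi.smul_apply, smul_eq_mul, ← Finset.mul_sum, Finset.sum_pi_single'] at this
    simp_all
  have h3 : finrank ℤ (Submodule.span ℤ {(Pi.single 0 1 : Fin (N + 1) → ℤ)}) = 1 := by
    have hli : LinearIndependent ℤ (fun _ : Unit => (Pi.single 0 1 : Fin (N + 1) → ℤ)) :=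
      .of_subsingleton () (by simp)
    have := finrank_span_eq_card hli
    rwa [Set.range_const, Fintype.card_unit] at this
  rw [hinf, rank_bot, add_zero, ← finrank_eq_rank, ← finrank_eq_rank, ← finrank_eq_rank, h3] at h2
  have h4 : finrank ℤ (chartLattice L) = finrank ℤ L + 1 := by
    exact_mod_cast h2
  rw [h4, finrank_fin_fun] at h1
  lia

open AddMonoidAlgebra

/-- Restriction of polynomials to the coset of `L`, in the chart `x_0 = α_0`: the algebra map
`K[x_0, ..., x_N] → K[ℤ^(N+1) / (L + ℤ e_0)]` sending `x_k` to `α_k [e_k]`. -/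
def cosetRestriction (α : Fin (N + 1) → Kˣ) (L : Submodule ℤ (Fin (N + 1) → ℤ)) :
    MvPolynomial (Fin (N + 1)) K →ₐ[K] K[(Fin (N + 1) → ℤ) ⧸ chartLattice L] :=
  MvPolynomial.aeval fun k => single (Submodule.Quotient.mk (Pi.single k 1)) (α k : K)

theorem chartLattice_le_ker {L : Submodule ℤ (Fin (N + 1) → ℤ)} {u : Fin (N + 1) → Kˣ}
    (h0 : u 0 = 1) (hu : L ≤ LinearMap.ker (torusCharacter u)) :
    chartLattice L ≤ LinearMap.ker (torusCharacter u) := by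
  refine sup_le hu ?_
  rw [Submodule.span_singleton_le_iff_mem, LinearMap.mem_ker]
  simp [torusCharacter, h0]

/-- Evaluation at the point of coordinates `u` of functions on the coset of `L`. The hypothesis says
that `u_0 = 1` and that the point lies on the coset. -/
def cosetEval {L : Submodule ℤ (Fin (N + 1) → ℤ)} (u : Fin (N + 1) → Kˣ)
    (hu : chartLattice L ≤ LinearMap.ker (torusCharacter u)) :
    K[(Fin (N + 1) → ℤ) ⧸ chartLattice L] →ₐ[K] K :=
  lift K K _ ((Units.coeHom K).comp
    (AddMonoidHom.toMultiplicativeLeft ((chartLattice L).liftQ _ hu).toAddMonoidHom))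

theorem cosetEval_single {L : Submodule ℤ (Fin (N + 1) → ℤ)} {u : Fin (N + 1) → Kˣ}
    (hu : chartLattice L ≤ LinearMap.ker (torusCharacter u)) (l : Fin (N + 1) → ℤ) (c : K) :
    cosetEval u hu (single (Submodule.Quotient.mk l) c) =
      c * ((torusCharacter u l).toMul : Kˣ) := by
  rw [cosetEval, lift_single]
  rfl

theorem cosetEval_cosetRestriction {L : Submodule ℤ (Fin (N + 1) → ℤ)} {α u : Fin (N + 1) → Kˣ}
    (hu : chartLattice L ≤ LinearMap.ker (torusCharacter u)) (f : MvPolynomial (Fin (N + 1)) K) :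
    cosetEval u hu (cosetRestriction α L f) =
      MvPolynomial.eval (fun k => (α k * u k : K)) f := by
  rw [← MvPolynomial.aeval_eq_eval, ← AlgHom.comp_apply]
  congr 1
  apply MvPolynomial.algHom_ext
  intro k
  simp [cosetRestriction, cosetEval_single, torusCharacter]

theorem cosetRestriction_monomial (α : Fin (N + 1) → Kˣ) (L : Submodule ℤ (Fin (N + 1) → ℤ))
    (a : Fin (N + 1) →₀ ℕ) (c : K) :
    cosetRestriction α L (MvPolynomial.monomial a c) =
      single (Submodule.Quotient.mk fun k => (a k : ℤ)) (c * ∏ k, (α k : K) ^ a k) := by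
  rw [cosetRestriction, MvPolynomial.aeval_monomial, Finsupp.prod_fintype _ _ (by simp)]
  have hprod (s : Finset (Fin (N + 1))) : ∏ k ∈ s,
      (single (Submodule.Quotient.mk (p := chartLattice L) (Pi.single k 1)) (α k : K)) ^ a k =
      single (Submodule.Quotient.mk (∑ k ∈ s, a k • Pi.single k 1)) (∏ k ∈ s, (α k : K) ^ a k) := by
    induction s using Finset.cons_induction with
    | empty => rfl
    | cons k s hk ih =>
      rw [Finset.prod_cons, Finset.prod_cons, Finset.sum_cons, ih, single_pow, single_mul_single]
      rfl
  have hsum : ∑ k, a k • (Pi.single k 1 : Fin (N + 1) → ℤ) = fun k => (a k : ℤ) := by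
    ext j
    simp [Finset.sum_apply, Pi.single_apply]
  rw [hprod, hsum, ← Algebra.smul_def, smul_single, smul_eq_mul]

/-- Up to a monomial, every function on the coset is the restriction of a homogeneous polynomial:
the factor `x_0 ^ n ⋯ x_N ^ n` clears denominators, and powers of `x_0 / α_0`, which restricts to
`1`, adjust the degree. -/
theorem exists_homogeneous_cosetRestriction_eq (α : Fin (N + 1) → Kˣ)
    (L : Submodule ℤ (Fin (N + 1) → ℤ)) (g : K[(Fin (N + 1) → ℤ) ⧸ chartLattice L]) :
    ∀ᶠ n : ℕ in Filter.atTop, ∀ᶠ D : ℕ in Filter.atTop, ∃ f : MvPolynomial (Fin (N + 1)) K,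
      f.IsHomogeneous D ∧
        cosetRestriction α L f = single (Submodule.Quotient.mk fun _ => (n : ℤ)) 1 * g := by
  induction g using AddMonoidAlgebra.induction_on with
  | of x =>
    obtain ⟨l, rfl⟩ := Submodule.Quotient.mk_surjective _ x
    have hl : ∀ᶠ n : ℕ in Filter.atTop, ∀ k, 0 ≤ n + l k := by
      rw [Filter.eventually_all]
      intro k
      filter_upwards [Filter.eventually_ge_atTop (l k).natAbs] with n hn
      lia
    filter_upwards [hl] with n hn
    let a : Fin (N + 1) →₀ ℕ := Finsupp.equivFunOnFinite.symm fun k => (n + l k).toNat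
    filter_upwards [Filter.eventually_ge_atTop a.degree] with D hD
    let b : Fin (N + 1) →₀ ℕ := a + Finsupp.single 0 (D - a.degree)
    refine ⟨.monomial b (∏ k, (α k : K) ^ b k)⁻¹,
      MvPolynomial.isHomogeneous_monomial _ ?_, ?_⟩
    · rw [map_add, Finsupp.degree_single, Nat.add_sub_cancel' hD]
    · have hprod : ∏ k, (α k : K) ^ b k ≠ 0 :=
        Finset.prod_ne_zero_iff.mpr fun k _ => pow_ne_zero _ (α k).ne_zero
      rw [cosetRestriction_monomial, inv_mul_cancel₀ hprod, of_apply, toAdd_ofAdd,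
        single_mul_single, one_mul, ← Submodule.Quotient.mk_add]
      congr 1
      rw [Submodule.Quotient.eq]
      -- the two exponents differ by the padding at `x_0`, which is zero modulo `ℤ e_0`
      refine Submodule.mem_sup_right
        (Submodule.mem_span_singleton.mpr ⟨(D - a.degree : ℕ), ?_⟩)
      ext k
      simp only [b, a, Pi.smul_apply, Pi.sub_apply, Pi.add_apply, Finsupp.add_apply,
        Finsupp.equivFunOnFinite_symm_apply_apply, Finsupp.single_apply, Pi.single_apply,
        Nat.cast_add, Int.toNat_of_nonneg (hn k), smul_eq_mul]
      rcases eq_or_ne k 0 with rfl | hk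
      · simp
      · simp [hk, hk.symm]
  | add g h hg hh =>
    filter_upwards [hg, hh] with n hgn hhn
    filter_upwards [hgn, hhn]
    rintro D ⟨f, hf, hfg⟩ ⟨f', hf', hfh⟩
    refine ⟨f + f', hf.add hf', ?_⟩
    rw [map_add, hfg, hfh, mul_add]
  | smul r g hg =>
    filter_upwards [hg] with n hgn
    filter_upwards [hgn]
    rintro D ⟨f, hf, hfg⟩
    refine ⟨MvPolynomial.C r * f, hf.C_mul r, ?_⟩
    rw [← MvPolynomial.smul_eq_C_mul, map_smul, hfg, mul_smul_comm]

/-- The map from the coset of `L` to the spectrum of its coordinate ring: a point goes to the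
kernel of evaluation there. The coordinates `u` of a point are normalized by `u_0 = 1`, which
determines them (`cosetToSpec_torusPoint`). -/
def cosetToSpec {α : Fin (N + 1) → Kˣ} {L : Submodule ℤ (Fin (N + 1) → ℤ)}
    (hL : ∀ l ∈ L, ∑ k, l k = 0) (p : toricCoset α L) :
    PrimeSpectrum K[(Fin (N + 1) → ℤ) ⧸ chartLattice L] :=
  have h := (exists_normalized_of_mem_toricCoset hL p.2).choose_spec
  ⟨RingHom.ker (cosetEval _ (chartLattice_le_ker h.1 h.2.1)), RingHom.ker_isPrime _⟩

theorem cosetToSpec_torusPoint {α : Fin (N + 1) → Kˣ} {L : Submodule ℤ (Fin (N + 1) → ℤ)}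
    (hL : ∀ l ∈ L, ∑ k, l k = 0) {u : Fin (N + 1) → Kˣ} (h0 : u 0 = 1)
    (hu : L ≤ LinearMap.ker (torusCharacter u)) :
    (cosetToSpec hL ⟨torusPoint α u, u, hu, rfl⟩).asIdeal =
      RingHom.ker (cosetEval u (chartLattice_le_ker h0 hu)) := by
  have hp : torusPoint α u ∈ toricCoset α L := ⟨u, hu, rfl⟩
  have h := (exists_normalized_of_mem_toricCoset hL hp).choose_spec
  have huw : (exists_normalized_of_mem_toricCoset hL hp).choose = u := by
    obtain ⟨c, hc⟩ := (torusPoint_eq_iff _ _ _).mp h.2.2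
    have hc0 := hc 0
    rw [h.1, h0, mul_one] at hc0
    funext k
    rw [hc k, ← hc0, one_mul]
  simp only [cosetToSpec]
  congr! 2

theorem mem_cosetToSpec_iff {α : Fin (N + 1) → Kˣ} {L : Submodule ℤ (Fin (N + 1) → ℤ)}
    (hL : ∀ l ∈ L, ∑ k, l k = 0) (p : toricCoset α L) {f : MvPolynomial (Fin (N + 1)) K} {D : ℕ}
    (hf : f.IsHomogeneous D) :
    cosetRestriction α L f ∈ (cosetToSpec hL p).asIdeal ↔ VanishesAt f p := by
  obtain ⟨p, hp⟩ := p
  obtain ⟨u, h0, hu, rfl⟩ := exists_normalized_of_mem_toricCoset hL hp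
  rw [cosetToSpec_torusPoint hL h0 hu, RingHom.mem_ker, vanishesAt_torusPoint_iff hf]
  exact iff_of_eq (congrArg (· = 0) (cosetEval_cosetRestriction _ f))

theorem cosetToSpec_isInducing {α : Fin (N + 1) → Kˣ} {L : Submodule ℤ (Fin (N + 1) → ℤ)}
    (hL : ∀ l ∈ L, ∑ k, l k = 0) :
    Topology.IsInducing (cosetToSpec (α := α) hL) := by
  refine ⟨le_antisymm ?_ ?_⟩
  · rw [← continuous_iff_le_induced, PrimeSpectrum.isTopologicalBasis_basic_opens.continuous_iff]
    rintro _ ⟨g, rfl⟩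
    obtain ⟨n, hn⟩ := (exists_homogeneous_cosetRestriction_eq α L g).exists
    obtain ⟨D, f, hf, hfg⟩ := hn.exists
    have hunit : IsUnit (single (Submodule.Quotient.mk fun _ => (n : ℤ)) 1 :
        K[(Fin (N + 1) → ℤ) ⧸ chartLattice L]) := by
      refine IsUnit.of_mul_eq_one (single (-Submodule.Quotient.mk fun _ => (n : ℤ)) 1) ?_
      rw [single_mul_single, add_neg_cancel, one_mul]
      rfl
    have : cosetToSpec (α := α) hL ⁻¹' (PrimeSpectrum.basicOpen g) =
        Subtype.val ⁻¹' (zeroSet {f})ᶜ := by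
      ext p
      simp only [zeroSet, Set.mem_singleton_iff, forall_eq, Set.mem_preimage, SetLike.mem_coe,
        PrimeSpectrum.mem_basicOpen, Set.mem_compl_iff, Set.mem_ofPred_eq,
        ← mem_cosetToSpec_iff hL p hf, hfg]
      rw [Ideal.unit_mul_mem_iff_mem _ hunit]
    rw [this]
    exact (isClosed_zeroSet_singleton hf).isOpen_compl.preimage continuous_subtype_val
  · rw [instTopologicalSpaceSubtype, zariskiTopology, induced_generateFrom_eq]
    refine le_generateFrom ?_
    rintro _ ⟨_, ⟨D, f, hf, rfl⟩, rfl⟩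
    refine isOpen_induced_iff.mpr ⟨PrimeSpectrum.basicOpen (cosetRestriction α L f),
      (PrimeSpectrum.basicOpen _).isOpen, ?_⟩
    ext p
    simp only [zeroSet, Set.mem_singleton_iff, forall_eq, Set.mem_preimage, SetLike.mem_coe,
      PrimeSpectrum.mem_basicOpen, Set.mem_compl_iff, Set.mem_ofPred_eq,
      ← mem_cosetToSpec_iff hL p hf]

instance finiteType_coordinateRing (L : Submodule ℤ (Fin (N + 1) → ℤ)) :
    Algebra.FiniteType K K[(Fin (N + 1) → ℤ) ⧸ chartLattice L] := by
  have : AddMonoid.FG ((Fin (N + 1) → ℤ) ⧸ chartLattice L) :=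
    AddGroup.fg_iff_addMonoid_fg.mp (Module.Finite.iff_addGroup_fg.mp inferInstance)
  infer_instance

/-- The Nullstellensatz: a maximal ideal of the coordinate ring is the kernel of a character. -/
theorem range_cosetToSpec [IsAlgClosed K] {α : Fin (N + 1) → Kˣ}
    {L : Submodule ℤ (Fin (N + 1) → ℤ)} (hL : ∀ l ∈ L, ∑ k, l k = 0) :
    Set.range (cosetToSpec (α := α) hL) = closedPoints _ := by
  ext x
  rw [mem_closedPoints_iff, PrimeSpectrum.isClosed_singleton_iff_isMaximal]
  constructor
  · rintro ⟨p, rfl⟩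
    exact RingHom.ker_isMaximal_of_surjective _ fun c => ⟨algebraMap K _ c, AlgHom.commutes _ c⟩
  · intro hx
    let R := K[(Fin (N + 1) → ℤ) ⧸ chartLattice L]
    let := Ideal.Quotient.field x.asIdeal
    have : Module.Finite K (R ⧸ x.asIdeal) := finite_of_finite_type_of_isJacobsonRing K _
    let e : K ≃ₐ[K] R ⧸ x.asIdeal := AlgEquiv.ofBijective (Algebra.ofId K _)
      IsAlgClosed.algebraMap_bijective_of_isIntegral
    let ev : R →ₐ[K] K := e.symm.toAlgHom.comp (Ideal.Quotient.mkₐ K x.asIdeal)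
    have hker : RingHom.ker ev = x.asIdeal := by
      ext g
      simp [ev, RingHom.mem_ker, Ideal.Quotient.eq_zero_iff_mem]
    let θ : Multiplicative ((Fin (N + 1) → ℤ) ⧸ chartLattice L) →* Kˣ :=
      ((lift K K _).symm ev).toHomUnits
    let u : Fin (N + 1) → Kˣ := fun k => θ (.ofAdd (Submodule.Quotient.mk (Pi.single k 1)))
    have hχ : torusCharacter u =
        (MonoidHom.toAdditiveRight θ).toIntLinearMap ∘ₗ (chartLattice L).mkQ := by
      refine LinearMap.pi_ext' fun k => LinearMap.ext_ring ?_
      simp [torusCharacter, u]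
    have hu : chartLattice L ≤ LinearMap.ker (torusCharacter u) := by
      intro l hl
      rw [LinearMap.mem_ker, hχ, LinearMap.comp_apply, Submodule.mkQ_apply,
        (Submodule.Quotient.mk_eq_zero _).mpr hl, map_zero]
    have h0 : u 0 = 1 := by
      have he : Submodule.Quotient.mk (p := chartLattice L) (Pi.single 0 1) = 0 :=
        (Submodule.Quotient.mk_eq_zero _).mpr
          (Submodule.mem_sup_right (Submodule.mem_span_singleton_self _))
      simp only [u, he, ofAdd_zero, map_one]
    refine ⟨⟨torusPoint α u, u, le_sup_left.trans hu, rfl⟩, PrimeSpectrum.ext ?_⟩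
    rw [cosetToSpec_torusPoint hL h0 (le_sup_left.trans hu), ← hker]
    congr 1
    refine AddMonoidAlgebra.algHom_ext (φ₁ := cosetEval u hu) (φ₂ := ev) (fun q => ?_)
      (Subsingleton.elim _ _)
    obtain ⟨l, rfl⟩ := Submodule.Quotient.mk_surjective _ q
    rw [cosetEval_single, one_mul, hχ]
    rfl

/-- A coset of the subgroup defined by `L` has dimension `N - rank L`. -/
theorem zariskiDim_toricCoset_add [IsAlgClosed K] (α : Fin (N + 1) → Kˣ)
    {L : Submodule ℤ (Fin (N + 1) → ℤ)} (hL : ∀ l ∈ L, ∑ k, l k = 0) :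
    zariskiDim (toricCoset α L) + (finrank ℤ L : WithBot ℕ∞) = (N : WithBot ℕ∞) := by
  have : IsJacobsonRing K[(Fin (N + 1) → ℤ) ⧸ chartLattice L] :=
    isJacobsonRing_of_finiteType (A := K)
  rw [zariskiDim, topologicalKrullDim_eq_of_isInducing_of_range_eq_closedPoints
    (cosetToSpec_isInducing hL) (range_cosetToSpec hL),
    PrimeSpectrum.topologicalKrullDim_eq_ringKrullDim, ringKrullDim_addMonoidAlgebra]
  exact_mod_cast finrank_quotient_chartLattice hL

end Torus

/-! ### Equations of a toric variety on the torus -/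

section Equations

variable {K : Type*} [Field K] {N m : ℕ}

theorem mem_toricLattice_iff {A : Fin (N + 1) → Fin m → ℤ} {l : Fin (N + 1) → ℤ} :
    l ∈ toricLattice A ↔ ∑ k, l k = 0 ∧ ∀ j, ∑ k, l k * A k j = 0 := by
  simp [toricLattice, Fintype.linearCombination_apply, Prod.ext_iff, Prod.fst_sum, Prod.snd_sum,
    funext_iff, Finset.sum_apply]

/-- The vectors `l ∈ Γ` with `‖l‖₁ ≤ 2 D`, the exponent differences of binomials of degree `D`. -/
def shortVectors (Γ : Submodule ℤ (Fin (N + 1) → ℤ)) (D : ℕ) : Set (Fin (N + 1) → ℤ) :=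
  {l | l ∈ Γ ∧ l1Norm l ≤ 2 * D}

theorem l1Norm_neg (l : Fin (N + 1) → ℤ) : l1Norm (-l) = l1Norm l := by
  simp [l1Norm]

theorem two_mul_sum_toNat {l : Fin (N + 1) → ℤ} (hl : ∑ k, l k = 0) :
    2 * ((∑ k, (l k).toNat : ℕ) : ℝ) = l1Norm l := by
  have h (k : Fin (N + 1)) : 2 * (((l k).toNat : ℕ) : ℤ) = |l k| + l k := by
    rcases le_total 0 (l k) with h | h
    · rw [abs_of_nonneg h]; lia
    · rw [abs_of_nonpos h]; lia
  have hZ : 2 * ((∑ k, (l k).toNat : ℕ) : ℤ) = ∑ k, |l k| := by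
    rw [Nat.cast_sum, Finset.mul_sum, Finset.sum_congr rfl fun k _ => h k,
      Finset.sum_add_distrib, hl, add_zero]
  rw [l1Norm]
  exact_mod_cast hZ

/-- The exponent of the monomial `x_0 ^ e * ∏ k, x_k ^ max (l_k, 0)`, where `e` is chosen to give
it degree `D`. If the second factor has degree more than `D`, then `e = 0`. -/
def paddedExponent (l : Fin (N + 1) → ℤ) (D : ℕ) : Fin (N + 1) →₀ ℕ :=
  Finsupp.equivFunOnFinite.symm (fun k => (l k).toNat) +
    Finsupp.single 0 (D - ∑ k, (l k).toNat)

theorem degree_paddedExponent {l : Fin (N + 1) → ℤ} (hl : ∑ k, l k = 0) {D : ℕ}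
    (hD : l1Norm l ≤ 2 * D) : (paddedExponent l D).degree = D := by
  have h : ∑ k, (l k).toNat ≤ D := by
    rw [← two_mul_sum_toNat hl] at hD
    exact_mod_cast (mul_le_mul_iff_right₀ two_pos).mp hD
  rw [paddedExponent, map_add, Finsupp.degree_single, Finsupp.degree_eq_sum]
  exact Nat.add_sub_cancel' h

theorem paddedExponent_sub {l : Fin (N + 1) → ℤ} (hl : ∑ k, l k = 0) (D : ℕ)
    (k : Fin (N + 1)) :
    (paddedExponent l D k : ℤ) - (paddedExponent (-l) D k : ℤ) = l k := by
  have h : ∑ k, ((-l) k).toNat = ∑ k, (l k).toNat := by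
    have h1 := two_mul_sum_toNat hl
    have h2 := two_mul_sum_toNat (l := -l) (by simp [hl])
    rw [l1Norm_neg, ← h1] at h2
    exact_mod_cast mul_left_cancel₀ two_ne_zero h2
  rw [paddedExponent, paddedExponent, h]
  simp only [Finsupp.add_apply, Finsupp.equivFunOnFinite_symm_apply_apply,
    Pi.neg_apply, Nat.cast_add]
  lia

/-- The binomial of degree `D` which on the torus of `P^N` defines the coset
`(x / α) ^ l = 1`. -/
def latticeBinomial (α : Fin (N + 1) → Kˣ) (l : Fin (N + 1) → ℤ) (D : ℕ) :
    MvPolynomial (Fin (N + 1)) K :=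
  MvPolynomial.monomial (paddedExponent l D) (∏ k, (α k : K) ^ paddedExponent l D k)⁻¹ -
    MvPolynomial.monomial (paddedExponent (-l) D) (∏ k, (α k : K) ^ paddedExponent (-l) D k)⁻¹

theorem latticeBinomial_isBinomial (α : Fin (N + 1) → Kˣ) {l : Fin (N + 1) → ℤ}
    (hl : ∑ k, l k = 0) (hl0 : l ≠ 0) (D : ℕ) : IsBinomial (latticeBinomial α l D) := by
  refine ⟨_, _, _, _, ?_, ?_, ?_, rfl⟩
  · intro h
    refine hl0 (funext fun k => ?_)
    rw [← paddedExponent_sub hl D, h, sub_self, Pi.zero_apply]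
  all_goals
    exact inv_ne_zero (Finset.prod_ne_zero_iff.mpr fun k _ => pow_ne_zero _ (α k).ne_zero)

theorem latticeBinomial_isHomogeneous (α : Fin (N + 1) → Kˣ) {l : Fin (N + 1) → ℤ}
    (hl : ∑ k, l k = 0) {D : ℕ} (hD : l1Norm l ≤ 2 * D) :
    (latticeBinomial α l D).IsHomogeneous D := by
  refine (MvPolynomial.isHomogeneous_monomial _ (degree_paddedExponent hl hD)).sub
    (MvPolynomial.isHomogeneous_monomial _ (degree_paddedExponent ?_ ?_))
  · simp [hl]
  · rwa [l1Norm_neg]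

theorem vanishesAt_latticeBinomial_iff {α u : Fin (N + 1) → Kˣ} {l : Fin (N + 1) → ℤ}
    (hl : ∑ k, l k = 0) {D : ℕ} (hD : l1Norm l ≤ 2 * D) :
    VanishesAt (latticeBinomial α l D) (torusPoint α u) ↔ torusCharacter u l = 0 := by
  have hmon (a : Fin (N + 1) →₀ ℕ) : MvPolynomial.eval (fun k => (α k * u k : K))
      (MvPolynomial.monomial a (∏ k, (α k : K) ^ a k)⁻¹) = (∏ k, u k ^ a k : Kˣ) := by
    have hα : ∏ k, (α k : K) ^ a k ≠ 0 :=
      Finset.prod_ne_zero_iff.mpr fun k _ => pow_ne_zero _ (α k).ne_zero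
    rw [MvPolynomial.eval_monomial, Finsupp.prod_fintype _ _ (by simp)]
    simp only [mul_pow, Finset.prod_mul_distrib]
    rw [inv_mul_cancel_left₀ hα]
    simp
  rw [vanishesAt_torusPoint_iff (latticeBinomial_isHomogeneous α hl hD), latticeBinomial, map_sub,
    hmon, hmon, sub_eq_zero, Units.val_inj, torusCharacter_eq_zero_iff, ← div_eq_one,
    ← Finset.prod_div_distrib]
  simp_rw [← paddedExponent_sub hl D, zpow_sub, zpow_natCast, div_eq_mul_inv]

theorem monomialMap_eq_torusPoint (A : Fin (N + 1) → Fin m → ℤ) (α : Fin (N + 1) → Kˣ)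
    (s : Fin m → Kˣ) : monomialMap A α s = torusPoint α fun k => ∏ j, s j ^ A k j := rfl

theorem toricLattice_le_ker_torusCharacter (A : Fin (N + 1) → Fin m → ℤ) (s : Fin m → Kˣ) :
    toricLattice A ≤ LinearMap.ker (torusCharacter fun k => ∏ j, s j ^ A k j) := by
  intro l hl
  rw [LinearMap.mem_ker, torusCharacter_eq_zero_iff]
  simp_rw [← Finset.prod_zpow, ← zpow_mul]
  rw [Finset.prod_comm]
  refine Finset.prod_eq_one fun j _ => ?_
  simp_rw [mul_comm (A _ j)]
  rw [prod_zpow_eq_zpow_sum, (mem_toricLattice_iff.mp hl).2 j, zpow_zero]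

/-- The character `s ↦ s ^ χ` of `G_m^m`, with values in `K`. -/
def monomialCharacter (χ : Fin m → ℤ) : (Fin m → Kˣ) →* K where
  toFun s := (∏ j, s j ^ χ j : Kˣ)
  map_one' := by simp
  map_mul' s t := by simp [mul_zpow, Finset.prod_mul_distrib]

theorem monomialCharacter_injective [IsAlgClosed K] :
    Function.Injective (monomialCharacter : (Fin m → ℤ) → (Fin m → Kˣ) →* K) := by
  classical
  intro χ ψ h
  by_contra hne
  obtain ⟨j, hj⟩ := Function.ne_iff.mp hne
  have : Infinite K := IsAlgClosed.instInfinite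
  obtain ⟨c, hc⟩ := Infinite.exists_notMem_finset ({0, 1} : Finset K)
  simp only [Finset.mem_insert, Finset.mem_singleton, not_or] at hc
  -- a value `t` which the nontrivial character `t ↦ t ^ (χ j - ψ j)` does not send to `1`
  have hd : 0 < (χ j - ψ j).natAbs := Int.natAbs_pos.mpr (sub_ne_zero.mpr hj)
  obtain ⟨t, ht⟩ := IsAlgClosed.exists_pow_nat_eq c hd
  have ht0 : t ≠ 0 := by
    rintro rfl
    rw [zero_pow hd.ne'] at ht
    exact hc.1 ht.symm
  have h1 := DFunLike.congr_fun h (Pi.mulSingle j (Units.mk0 t ht0))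
  have hval (η : Fin m → ℤ) : ∏ i, (Pi.mulSingle j (Units.mk0 t ht0) : Fin m → Kˣ) i ^ η i =
      Units.mk0 t ht0 ^ η j := by
    rw [Finset.prod_eq_single j (fun i _ hi => by simp [Pi.mulSingle_eq_of_ne hi]) (by simp)]
    simp
  simp only [monomialCharacter, MonoidHom.coe_mk, OneHom.coe_mk, hval, Units.val_inj] at h1
  have h2 : Units.mk0 t ht0 ^ (χ j - ψ j).natAbs = 1 := by
    have h3 : Units.mk0 t ht0 ^ (χ j - ψ j) = 1 := by rw [zpow_sub, h1, mul_inv_cancel]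
    rcases abs_choice (χ j - ψ j) with hn | hn <;>
      rw [← zpow_natCast, Int.natCast_natAbs, hn]
    · exact h3
    · rw [zpow_neg, h3, inv_one]
  have h4 := congrArg Units.val h2
  rw [Units.val_pow_eq_pow_val, Units.val_mk0, ht] at h4
  exact hc.2 h4

theorem l1Norm_sub_le {a b : Fin (N + 1) →₀ ℕ} {D : ℕ} (ha : a.degree = D) (hb : b.degree = D) :
    l1Norm (fun k => (a k : ℤ) - b k) ≤ 2 * D := by
  have h : l1Norm (fun k => (a k : ℤ) - b k) ≤ ∑ k, ((a k : ℝ) + b k) := by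
    refine Finset.sum_le_sum fun k _ => ?_
    push_cast
    refine (abs_sub _ _).trans ?_
    simp
  refine h.trans_eq ?_
  rw [Finset.sum_add_distrib, ← Nat.cast_sum, ← Nat.cast_sum, ← Finsupp.degree_eq_sum,
    ← Finsupp.degree_eq_sum, ha, hb]
  ring

/-- A homogeneous polynomial of degree `D` vanishing on the image of the monomial map vanishes at
every point of the torus where the binomial equations of degree `D` hold. By linear independence of
characters, its terms cancel within each class of monomials having the same restriction to the
image, and monomials in one class differ by short vectors of the lattice. -/
theorem vanishesAt_torusPoint_of_mem_definingIdeal [IsAlgClosed K] {A : Fin (N + 1) → Fin m → ℤ}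
    {α u : Fin (N + 1) → Kˣ} {D : ℕ} {f : MvPolynomial (Fin (N + 1)) K} (hf : f.IsHomogeneous D)
    (hfX : f ∈ definingIdeal (Set.range (monomialMap A α)))
    (hu : ∀ l ∈ shortVectors (toricLattice A) D, torusCharacter u l = 0) :
    VanishesAt f (torusPoint α u) := by
  classical
  let wt : (Fin (N + 1) →₀ ℕ) → Fin m → ℤ := fun a j => ∑ k, a k * A k j
  let c : (Fin (N + 1) →₀ ℕ) → K := fun a => f.coeff a * ∏ k, (α k : K) ^ a k
  have heval (w : Fin (N + 1) → Kˣ) : MvPolynomial.eval (fun k => (α k * w k : K)) f =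
      ∑ χ ∈ f.support.image wt, ∑ a ∈ f.support with wt a = χ,
        c a * (∏ k, w k ^ a k : Kˣ) := by
    rw [MvPolynomial.eval_eq', Finset.sum_fiberwise_of_maps_to
      fun a ha => Finset.mem_image_of_mem wt ha]
    refine Finset.sum_congr rfl fun a _ => ?_
    simp only [c, mul_pow, Finset.prod_mul_distrib, Units.coe_prod, Units.val_pow_eq_pow_val]
    ring
  have hzero : ∀ χ ∈ f.support.image wt, ∑ a ∈ f.support with wt a = χ, c a = 0 := by
    have hli := (linearIndependent_monoidHom (Fin m → Kˣ) K).comp monomialCharacter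
      (monomialCharacter_injective (m := m))
    refine linearIndependent_iff'.mp hli (f.support.image wt)
      (fun χ => ∑ a ∈ f.support with wt a = χ, c a) (funext fun s => ?_)
    have h0 := (vanishesAt_torusPoint_iff hf α _).mp (hfX _ ⟨s, monomialMap_eq_torusPoint A α s⟩)
    rw [heval] at h0
    rw [Finset.sum_apply, Pi.zero_apply, ← h0]
    refine Finset.sum_congr rfl fun χ _ => ?_
    rw [Pi.smul_apply, smul_eq_mul, Finset.sum_mul]
    refine Finset.sum_congr rfl fun a ha => ?_
    congr 1
    rw [← (Finset.mem_filter.mp ha).2]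
    simp only [Function.comp_apply, monomialCharacter, MonoidHom.coe_mk, OneHom.coe_mk,
      Units.val_inj, wt]
    simp_rw [← Finset.prod_pow]
    rw [Finset.prod_comm]
    refine Finset.prod_congr rfl fun j _ => ?_
    rw [← prod_zpow_eq_zpow_sum]
    simp_rw [mul_comm _ (A _ j), zpow_mul, zpow_natCast]
  rw [vanishesAt_torusPoint_iff hf, heval]
  refine Finset.sum_eq_zero fun χ hχ => ?_
  obtain ⟨b, hb, rfl⟩ := Finset.mem_image.mp hχ
  have hdeg {a : Fin (N + 1) →₀ ℕ} (ha : a ∈ f.support) : a.degree = D := by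
    by_contra hne
    exact MvPolynomial.mem_support_iff.mp ha (hf.coeff_eq_zero hne)
  have hconst : ∀ a ∈ f.support.filter (fun a => wt a = wt b),
      c a * (∏ k, u k ^ a k : Kˣ) = c a * (∏ k, u k ^ b k : Kˣ) := by
    intro a ha
    obtain ⟨ha, hab⟩ := Finset.mem_filter.mp ha
    have hl := hu (fun k => (a k : ℤ) - b k) ⟨?_, l1Norm_sub_le (hdeg ha) (hdeg hb)⟩
    · rw [torusCharacter_eq_zero_iff] at hl
      simp_rw [zpow_sub, zpow_natCast, ← div_eq_mul_inv] at hl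
      rw [Finset.prod_div_distrib, div_eq_one] at hl
      rw [hl]
    · rw [mem_toricLattice_iff]
      constructor
      · rw [Finset.sum_sub_distrib, ← Nat.cast_sum, ← Nat.cast_sum, ← Finsupp.degree_eq_sum,
          ← Finsupp.degree_eq_sum, hdeg ha, hdeg hb, sub_self]
      · intro j
        simp_rw [sub_mul]
        rw [Finset.sum_sub_distrib]
        exact sub_eq_zero.mpr (congrFun hab j)
  rw [Finset.sum_congr rfl hconst, ← Finset.sum_mul, hzero _ hχ, zero_mul]

theorem mem_definingIdeal_closure {X : Set (ProjSpace K N)} {D : ℕ}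
    {f : MvPolynomial (Fin (N + 1)) K} (hf : f.IsHomogeneous D) (hfX : f ∈ definingIdeal X) :
    f ∈ definingIdeal (closure X) := by
  have hsub : closure X ⊆ zeroSet {f} := closure_minimal (fun p hp => by
    rintro _ rfl
    exact hfX p hp) (isClosed_zeroSet_singleton hf)
  exact fun p hp => hsub hp f rfl

theorem latticeBinomial_mem_idealPart {A : Fin (N + 1) → Fin m → ℤ} (α : Fin (N + 1) → Kˣ)
    {l : Fin (N + 1) → ℤ} {D : ℕ} (hl : l ∈ shortVectors (toricLattice A) D) :
    latticeBinomial α l D ∈ idealPart (toricVariety A α) D := by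
  have hsum := (mem_toricLattice_iff.mp hl.1).1
  have hhom := latticeBinomial_isHomogeneous α hsum hl.2
  refine ⟨mem_definingIdeal_closure hhom ?_, hhom⟩
  rintro _ ⟨s, rfl⟩
  rw [monomialMap_eq_torusPoint, vanishesAt_latticeBinomial_iff hsum hl.2]
  exact toricLattice_le_ker_torusCharacter A s hl.1

/-- On the torus, the equations of degree `D` of the toric variety cut out the coset of the
sublattice generated by the short vectors. -/
theorem zeroSet_idealPart_inter_openTorus [IsAlgClosed K] (A : Fin (N + 1) → Fin m → ℤ)
    (α : Fin (N + 1) → Kˣ) (D : ℕ) :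
    zeroSet (idealPart (toricVariety A α) D) ∩ openTorus K N =
      toricCoset α (Submodule.span ℤ (shortVectors (toricLattice A) D)) := by
  apply Set.Subset.antisymm
  · rintro p ⟨hp, hpT⟩
    obtain ⟨u, rfl⟩ := exists_eq_torusPoint α hpT
    refine ⟨u, Submodule.span_le.mpr fun l hl => ?_, rfl⟩
    exact (vanishesAt_latticeBinomial_iff (mem_toricLattice_iff.mp hl.1).1 hl.2).mp
      (hp _ (latticeBinomial_mem_idealPart α hl))
  · rintro _ ⟨u, hu, rfl⟩
    refine ⟨fun f hf => ?_, torusPoint_mem_openTorus α u⟩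
    exact vanishesAt_torusPoint_of_mem_definingIdeal hf.2
      (fun p hp => hf.1 p (subset_closure hp)) fun l hl => hu (Submodule.subset_span hl)

theorem zeroSet_latticeBinomial_inter_openTorus (α : Fin (N + 1) → Kˣ)
    {ι : Type*} {v : ι → Fin (N + 1) → ℤ} {d : ι → ℕ} (hv : ∀ j, ∑ k, v j k = 0)
    (hd : ∀ j, l1Norm (v j) ≤ 2 * d j) (s : Set ι) :
    zeroSet {g | ∃ j ∈ s, g = latticeBinomial α (v j) (d j)} ∩ openTorus K N =
      toricCoset α (Submodule.span ℤ (v '' s)) := by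
  apply Set.Subset.antisymm
  · rintro p ⟨hp, hpT⟩
    obtain ⟨u, rfl⟩ := exists_eq_torusPoint α hpT
    refine ⟨u, Submodule.span_le.mpr ?_, rfl⟩
    rintro _ ⟨j, hj, rfl⟩
    exact (vanishesAt_latticeBinomial_iff (hv j) (hd j)).mp (hp _ ⟨j, hj, rfl⟩)
  · rintro _ ⟨u, hu, rfl⟩
    refine ⟨?_, torusPoint_mem_openTorus α u⟩
    rintro _ ⟨j, hj, rfl⟩
    exact (vanishesAt_latticeBinomial_iff (hv j) (hd j)).mpr
      (hu (Submodule.subset_span ⟨j, hj, rfl⟩))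

theorem isTopologicalBasis_zeroSet_compl : IsTopologicalBasis
    (insert Set.univ {W : Set (ProjSpace K N) | ∃ (D : ℕ) (f : MvPolynomial (Fin (N + 1)) K),
      f.IsHomogeneous D ∧ W = (zeroSet {f})ᶜ}) := by
  refine isTopologicalBasis_of_subbasis_of_inter rfl ?_
  rintro _ ⟨D, f, hf, rfl⟩ _ ⟨E, g, hg, rfl⟩
  refine ⟨D + E, f * g, hf.mul hg, ?_⟩
  rw [← Set.compl_union, compl_inj_iff]
  ext p
  induction p using Projectivization.ind with | h v hv
  simp [zeroSet, vanishesAt_mk_iff hf, vanishesAt_mk_iff hg, vanishesAt_mk_iff (hf.mul hg)]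

theorem toricCoset_subset_toricVariety [IsAlgClosed K] (A : Fin (N + 1) → Fin m → ℤ)
    (α : Fin (N + 1) → Kˣ) : toricCoset α (toricLattice A) ⊆ toricVariety A α := by
  rintro _ ⟨u, hu, rfl⟩
  rw [toricVariety, isTopologicalBasis_zeroSet_compl.mem_closure_iff]
  rintro _ (rfl | ⟨D, f, hf, rfl⟩) hp
  · exact ⟨_, trivial, fun _ => 1, rfl⟩
  · by_contra hempty
    refine hp ?_
    rintro _ rfl
    refine vanishesAt_torusPoint_of_mem_definingIdeal hf ?_ fun l hl => hu hl.1
    intro p hpX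
    by_contra hpf
    exact hempty ⟨p, fun h => hpf (h _ rfl), hpX⟩

/-- The coset of `Γ` lies in `X`, so `N - rank Γ ≤ dim X`. -/
theorem le_finrank_toricLattice_add [IsAlgClosed K] {n : ℕ} {A : Fin (N + 1) → Fin m → ℤ}
    {α : Fin (N + 1) → Kˣ} (hdim : zariskiDim (toricVariety A α) = (n : WithBot ℕ∞)) :
    N ≤ finrank ℤ (toricLattice A) + n := by
  have h1 : zariskiDim (toricCoset α (toricLattice A)) ≤ n := hdim ▸
    (Topology.IsEmbedding.inclusion
      (toricCoset_subset_toricVariety A α)).isInducing.topologicalKrullDim_le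
  have h2 := zariskiDim_toricCoset_add α (L := toricLattice A)
    fun l hl => (mem_toricLattice_iff.mp hl).1
  have h3 : (N : WithBot ℕ∞) ≤ n + finrank ℤ (toricLattice A) := by
    rw [← h2]
    gcongr
  rw [add_comm]
  exact_mod_cast h3

end Equations

/-! ### Successive minima -/

section Minima

variable {N : ℕ}

/-- The exchange property over a domain: `n` independent vectors extend by a member of any set
whose span has rank more than `n`. -/
theorem exists_linearIndependent_snoc_of_lt_finrank_span {R M : Type*} [CommRing R] [IsDomain R]
    [AddCommGroup M] [Module R M] [IsNoetherian R M] {n : ℕ} {v : Fin n → M}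
    (hv : LinearIndependent R v) {S : Set M} (h : n < finrank R (Submodule.span R S)) :
    ∃ s ∈ S, LinearIndependent R (Fin.snoc (α := fun _ => M) v s) := by
  by_contra! hS
  let W := Submodule.span R (Set.range v)
  have hsmul : ∀ s ∈ S, ∃ r : R, r ≠ 0 ∧ r • s ∈ W := by
    intro s hs
    by_contra! hr
    refine hS s hs (LinearIndependent.finSnoc' v s hv fun c y hy hcy => ?_)
    by_contra hc
    exact hr c hc (eq_neg_of_add_eq_zero_left hcy ▸ W.neg_mem hy)
  -- it suffices that `W ∩ span S` has smaller rank than `span S`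
  have hrank : finrank R (W.submoduleOf (Submodule.span R S)) ≤ n := by
    have hW : finrank R W = n := by rw [finrank_span_eq_card hv, Fintype.card_fin]
    let g : W.submoduleOf (Submodule.span R S) →ₗ[R] W :=
      ((Submodule.span R S).subtype ∘ₗ (W.submoduleOf (Submodule.span R S)).subtype).codRestrict W
        fun x => x.2
    refine hW ▸ LinearMap.finrank_le_finrank_of_injective (f := g) fun x y hxy => ?_
    exact Subtype.ext (Subtype.ext (congrArg (fun z : W => (z : M)) hxy))
  have hlt : Module.rank R (W.submoduleOf (Submodule.span R S)) <
      Module.rank R (Submodule.span R S) := by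
    rw [← finrank_eq_rank, ← finrank_eq_rank]
    exact_mod_cast hrank.trans_lt h
  obtain ⟨⟨x, hx⟩, hxr⟩ := Submodule.exists_smul_notMem_of_rank_lt hlt
  suffices ∃ r : R, r ≠ 0 ∧ r • x ∈ W by
    obtain ⟨r, hr, hrx⟩ := this
    exact hxr r hr hrx
  clear hxr
  induction hx using Submodule.span_induction with
  | mem s hs => exact hsmul s hs
  | zero => exact ⟨1, one_ne_zero, by simp⟩
  | add x y _ _ hx hy =>
    obtain ⟨r, hr, hrx⟩ := hx
    obtain ⟨t, ht, hty⟩ := hy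
    refine ⟨r * t, mul_ne_zero hr ht, ?_⟩
    rw [smul_add, mul_smul r t y, mul_comm, mul_smul]
    exact W.add_mem (W.smul_mem _ hrx) (W.smul_mem _ hty)
  | smul c x _ hx =>
    obtain ⟨r, hr, hrx⟩ := hx
    exact ⟨r, hr, smul_comm r c x ▸ W.smul_mem _ hrx⟩

/-- A greedy choice of independent vectors, the `j`-th one in a set whose span has rank at least
`j + 1`. -/
theorem exists_linearIndependent_forall_mem {R M : Type*} [CommRing R] [IsDomain R]
    [AddCommGroup M] [Module R M] [IsNoetherian R M] (S : ℕ → Set M) (n : ℕ)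
    (h : ∀ j < n, j + 1 ≤ finrank R (Submodule.span R (S j))) :
    ∃ v : Fin n → M, LinearIndependent R v ∧ ∀ j : Fin n, v j ∈ S j := by
  induction n with
  | zero => exact ⟨Fin.elim0, linearIndependent_empty_type, fun j => j.elim0⟩
  | succ n ih =>
    obtain ⟨v, hv, hvS⟩ := ih fun j hj => h j (hj.trans n.lt_succ_self)
    obtain ⟨s, hs, hvs⟩ := exists_linearIndependent_snoc_of_lt_finrank_span hv (h n n.lt_succ_self)
    refine ⟨_, hvs, fun j => ?_⟩
    refine Fin.lastCases ?_ (fun j => ?_) j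
    · simpa using hs
    · simpa using hvS j

theorem le_finrank_span_iff {R M : Type*} [CommRing R] [IsDomain R]
    [AddCommGroup M] [Module R M] [IsNoetherian R M] {S : Set M} {i : ℕ} :
    i ≤ finrank R (Submodule.span R S) ↔
      ∃ v : Fin i → M, LinearIndependent R v ∧ ∀ j, v j ∈ S := by
  constructor
  · exact fun h => exists_linearIndependent_forall_mem (fun _ => S) i fun j hj => hj.trans_le h
  · rintro ⟨v, hv, hvS⟩
    let w : Fin i → Submodule.span R S := fun j => ⟨v j, Submodule.subset_span (hvS j)⟩
    have hw : LinearIndependent R w := LinearIndependent.of_comp (Submodule.span R S).subtype hv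
    simpa using hw.fintype_card_le_finrank

/-- The bound `ν` can be lowered to an even integer, since the entries of a vector of `Γ` sum to
zero and so its norm is even. -/
theorem mem_minimumBounds_iff {Γ : Submodule ℤ (Fin (N + 1) → ℤ)} (hΓ : ∀ l ∈ Γ, ∑ k, l k = 0)
    {i : ℕ} {ν : ℝ} : ν ∈ minimumBounds Γ i ↔
      ∃ D : ℕ, 2 * (D : ℝ) ≤ ν ∧ i ≤ finrank ℤ (Submodule.span ℤ (shortVectors Γ D)) := by
  simp only [le_finrank_span_iff]
  constructor
  · rintro ⟨hν, v, hv, hvΓ⟩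
    refine ⟨⌊ν / 2⌋₊, ?_, v, hv, fun j => ⟨(hvΓ j).1, ?_⟩⟩
    · linarith [Nat.floor_le (show 0 ≤ ν / 2 by positivity)]
    · have h := (hvΓ j).2
      rw [← two_mul_sum_toNat (hΓ _ (hvΓ j).1)] at h ⊢
      gcongr
      exact Nat.le_floor (by linarith)
  · rintro ⟨D, hD, v, hv, hvS⟩
    exact ⟨le_trans (by positivity) hD, v, hv, fun j => ⟨(hvS j).1, (hvS j).2.trans hD⟩⟩

theorem exists_le_finrank_span_shortVectors (Γ : Submodule ℤ (Fin (N + 1) → ℤ)) :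
    ∃ D : ℕ, finrank ℤ Γ ≤ finrank ℤ (Submodule.span ℤ (shortVectors Γ D)) := by
  obtain ⟨v, hv⟩ := exists_linearIndependent_of_le_finrank (R := ℤ) (M := Γ) le_rfl
  obtain ⟨D, hD⟩ := exists_nat_ge (∑ j, l1Norm (v j : Fin (N + 1) → ℤ))
  refine ⟨D, le_finrank_span_iff.mpr ⟨fun j => v j, ?_, fun j => ⟨(v j).2, ?_⟩⟩⟩
  · exact hv.map' Γ.subtype Γ.ker_subtype
  · have hnn (l : Fin (N + 1) → ℤ) : 0 ≤ l1Norm l := Finset.sum_nonneg fun _ _ => abs_nonneg _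
    have := Finset.single_le_sum (f := fun j => l1Norm (v j : Fin (N + 1) → ℤ))
      (fun j _ => hnn _) (Finset.mem_univ j)
    have hD0 : (0 : ℝ) ≤ D := D.cast_nonneg
    linarith

end Minima

/-! ### Obstruction indices -/

section Obstruction

variable {K : Type*} [Field K] [IsAlgClosed K] {N m : ℕ}

theorem mem_obstructionDegrees_iff {A : Fin (N + 1) → Fin m → ℤ} {α : Fin (N + 1) → Kˣ}
    {i D : ℕ} : D ∈ obstructionDegrees (toricVariety A α) (openTorus K N) i ↔
      i ≤ finrank ℤ (Submodule.span ℤ (shortVectors (toricLattice A) D)) := by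
  have hL : ∀ l ∈ Submodule.span ℤ (shortVectors (toricLattice A) D), ∑ k, l k = 0 :=
    fun l hl => (mem_toricLattice_iff.mp (Submodule.span_le.mpr (fun _ h => h.1) hl)).1
  have hdim := zariskiDim_toricCoset_add α hL
  rw [obstructionDegrees, Set.mem_ofPred_eq, zeroSet_idealPart_inter_openTorus]
  generalize zariskiDim (toricCoset α (Submodule.span ℤ (shortVectors (toricLattice A) D))) = d
    at hdim
  generalize finrank ℤ (Submodule.span ℤ (shortVectors (toricLattice A) D)) = r at hdim
  constructor
  · intro h
    induction d with
    | bot => exact absurd hdim (by simp)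
    | coe d =>
      norm_cast at hdim h
      induction d using ENat.recTopCoe with
      | top => simp at hdim
      | coe d =>
        norm_cast at hdim h
        lia
  · intro h
    rw [← hdim]
    gcongr

theorem isLeast_obstructionIndex {A : Fin (N + 1) → Fin m → ℤ} {α : Fin (N + 1) → Kˣ}
    {i : ℕ} (hi : i ≤ finrank ℤ (toricLattice A)) :
    IsLeast (obstructionDegrees (toricVariety A α) (openTorus K N) i)
      (obstructionIndex (toricVariety A α) (openTorus K N) i) := by
  obtain ⟨D, hD⟩ := exists_le_finrank_span_shortVectors (toricLattice A)
  exact ⟨Nat.sInf_mem ⟨D, mem_obstructionDegrees_iff.mpr (hi.trans hD)⟩,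
    fun E hE => Nat.sInf_le hE⟩

theorem isLeast_two_mul_obstructionIndex {A : Fin (N + 1) → Fin m → ℤ} {α : Fin (N + 1) → Kˣ}
    {i : ℕ} (hi : i ≤ finrank ℤ (toricLattice A)) :
    IsLeast (minimumBounds (toricLattice A) i)
      (2 * (obstructionIndex (toricVariety A α) (openTorus K N) i : ℝ)) := by
  have hΓ : ∀ l ∈ toricLattice A, ∑ k, l k = 0 := fun l hl => (mem_toricLattice_iff.mp hl).1
  have h := isLeast_obstructionIndex (α := α) hi
  refine ⟨(mem_minimumBounds_iff hΓ).mpr ⟨_, le_rfl, mem_obstructionDegrees_iff.mp h.1⟩,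
    fun ν hν => ?_⟩
  obtain ⟨D, hD, hDi⟩ := (mem_minimumBounds_iff hΓ).mp hν
  refine le_trans ?_ hD
  gcongr
  exact h.2 (mem_obstructionDegrees_iff.mpr hDi)

end Obstruction

end ToricObstruction

end

open ToricObstruction
theorem mainTheorem3 {K : Type*} [Field K] [IsAlgClosed K] {N m n : ℕ}
    (A : Fin (N + 1) → Fin m → ℤ) (α : Fin (N + 1) → Kˣ)
    (hdim : zariskiDim (toricVariety A α) = (n : WithBot ℕ∞)) :
    (∀ i : ℕ, 1 ≤ i → i + n ≤ N →
      IsLeast (obstructionDegrees (toricVariety A α) (openTorus K N) i)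
        (obstructionIndex (toricVariety A α) (openTorus K N) i) ∧
      IsLeast (minimumBounds (toricLattice A) i) (successiveMinimum (toricLattice A) i) ∧
      (obstructionIndex (toricVariety A α) (openTorus K N) i : ℝ) =
        1 / 2 * successiveMinimum (toricLattice A) i) ∧
    (∃ f : Fin (N - n) → MvPolynomial (Fin (N + 1)) K,
      (∀ j, IsBinomial (f j) ∧
        f j ∈ idealPart (toricVariety A α)
          (obstructionIndex (toricVariety A α) (openTorus K N) (j + 1))) ∧
      ∀ i : ℕ, i + n ≤ N →
        zariskiDim (zeroSet {g | ∃ j : Fin (N - n), (j : ℕ) < i ∧ g = f j} ∩ openTorus K N) +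
          (i : WithBot ℕ∞) = (N : WithBot ℕ∞)) := by
  have hrank := le_finrank_toricLattice_add hdim
  constructor
  · intro i _ hi
    have hi' : i ≤ Module.finrank ℤ (toricLattice A) := by lia
    have hmin := isLeast_two_mul_obstructionIndex (α := α) hi'
    have hμ : successiveMinimum (toricLattice A) i = _ := hmin.csInf_eq
    refine ⟨isLeast_obstructionIndex hi', hμ ▸ hmin, ?_⟩
    rw [hμ]
    ring
  · obtain ⟨v, hv, hvS⟩ := exists_linearIndependent_forall_mem (R := ℤ)
      (fun j => shortVectors (toricLattice A)
        (obstructionIndex (toricVariety A α) (openTorus K N) (j + 1))) (N - n)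
      fun j hj => mem_obstructionDegrees_iff.mp (isLeast_obstructionIndex (by lia)).1
    have hsum (j) : ∑ k, v j k = 0 := (mem_toricLattice_iff.mp (hvS j).1).1
    refine ⟨fun j => latticeBinomial α (v j) _, fun j =>
      ⟨latticeBinomial_isBinomial α (hsum j) (hv.ne_zero j) _,
        latticeBinomial_mem_idealPart α (hvS j)⟩, fun i hi => ?_⟩
    have hin : i ≤ N - n := by lia
    have hset := zeroSet_latticeBinomial_inter_openTorus α hsum (fun j => (hvS j).2)
      {j | (j : ℕ) < i}
    have himage : v '' {j | (j : ℕ) < i} = Set.range (v ∘ Fin.castLE hin) := by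
      rw [Set.range_comp, Fin.range_castLE]
    have hfin : Module.finrank ℤ (Submodule.span ℤ (v '' {j | (j : ℕ) < i})) = i := by
      rw [himage, finrank_span_eq_card (hv.comp _ (Fin.castLE_injective hin)), Fintype.card_fin]
    have hL : ∀ l ∈ Submodule.span ℤ (v '' {j | (j : ℕ) < i}), ∑ k, l k = 0 := by
      intro l hl
      refine (mem_toricLattice_iff.mp
        (Submodule.span_le (p := toricLattice A).mpr ?_ hl)).1
      rintro _ ⟨j, -, rfl⟩
      exact (hvS j).1
    have hdimL := zariskiDim_toricCoset_add α hL
    rw [hfin, ← hset] at hdimL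
    exact hdimL
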